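/- For $d\ge 1$ let $B_d$ be the group of all bijections $\sigma$ of $\{\pm1,\dots,\pm d\}$ onto itself with $\sigma_{-i}=-\sigma_i$ for all $i$. For $\sigma\in B_d$ put $\sigma_0=0$ and let $\mathrm{des}_B(\sigma)$ be the number of $i\in\{0,1,\dots,d-1\}$ with $\sigma_i>\sigma_{i+1}$. For $1\le j\le d$ define the $j$-Eulerian polynomials of types $B^+$ and $B^-$ by $$B^+_{d,j}(t)=\sum_{\substack{\sigma\in B_d\\ \sigma_1=j,\ \sigma_d>0}}t^{\mathrm{des}_B(\sigma)},\qquad B^-_{d,j}(t)=\sum_{\substack{\sigma\in B_d\\ \sigma_1=j,\ \sigma_d<0}}t^{\mathrm{des}_B(\sigma)}.$$ Then for all $d\ge1$ and $1\le j\le d$ the polynomials $B^+_{d,j}(t)$ and $B^-_{d,j}(t)$ are real-rooted, that is, all their complex zeros are real (the zero polynomial, which occurs as $B^-_{1,1}$, is counted as real-rooted). -/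

import Mathlib

open Polynomial

/-- The set `{±1, …, ±d}`. -/
abbrev SignedSet (d : ℕ) : Type := {x : ℤ // x ≠ 0 ∧ -(d : ℤ) ≤ x ∧ x ≤ (d : ℤ)}

instance (d : ℕ) : Fintype (SignedSet d) :=
  Fintype.subtype (((Finset.range (2 * d + 1)).image fun k : ℕ => (k : ℤ) - d).erase 0) <| by
    intro x
    simp only [Finset.mem_erase, Finset.mem_image, Finset.mem_range]
    constructor
    · rintro ⟨h0, k, hk, rfl⟩
      omega
    · rintro ⟨h0, h1, h2⟩
      exact ⟨h0, (x + d).toNat, by omega, by omega⟩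

instance (d : ℕ) : Neg (SignedSet d) where
  neg x := ⟨-x.1, by have h := x.2; omega⟩

/-- The signed permutations of `{±1, …, ±d}` (the elements of the hyperoctahedral group `B_d`):
the bijections `σ` of this set onto itself with `σ (-i) = -σ i` for all `i`. -/
abbrev SignedPerm (d : ℕ) : Type := {σ : Equiv.Perm (SignedSet d) // ∀ i, σ (-i) = -σ i}

namespace SignedPerm

/-- The entry `σ_i` of a signed permutation, for `i ∈ {1, …, d}`, together with the convention
`σ_0 = 0` (and the value `0` for `i > d`, which is never used below). -/
def entry {d : ℕ} (σ : SignedPerm d) (i : ℕ) : ℤ :=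
  if h : 1 ≤ i ∧ i ≤ d then
    (σ.1 ⟨(i : ℤ), by omega⟩ : ℤ)
  else 0

/-- The descent set `Des_B(σ) = {i ∈ [0, d-1] : σ_i > σ_{i+1}}`. -/
def descentSet {d : ℕ} (σ : SignedPerm d) : Finset ℕ :=
  (Finset.range d).filter fun i => σ.entry i > σ.entry (i + 1)

/-- The descent number `des_B(σ)`. -/
def des {d : ℕ} (σ : SignedPerm d) : ℕ := σ.descentSet.card

/-- The set of `σ ∈ B_d` with `σ_d > 0` and `σ_1 = j`. -/
def plusWithFirst (d : ℕ) (j : ℤ) : Finset (SignedPerm d) :=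
  Finset.univ.filter fun σ => 0 < σ.entry d ∧ σ.entry 1 = j

/-- The set of `σ ∈ B_d` with `σ_d < 0` and `σ_1 = j`. -/
def minusWithFirst (d : ℕ) (j : ℤ) : Finset (SignedPerm d) :=
  Finset.univ.filter fun σ => σ.entry d < 0 ∧ σ.entry 1 = j

end SignedPerm

/-- The `j`-Eulerian polynomial of type `B⁺`. -/
noncomputable def eulerianBPlus (d : ℕ) (j : ℤ) : ℝ[X] :=
  ∑ σ ∈ SignedPerm.plusWithFirst d j, X ^ σ.des

/-- The `j`-Eulerian polynomial of type `B⁻`. -/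
noncomputable def eulerianBMinus (d : ℕ) (j : ℤ) : ℝ[X] :=
  ∑ σ ∈ SignedPerm.minusWithFirst d j, X ^ σ.des

/-- A real polynomial is real-rooted if it is the zero polynomial or all its complex zeros
are real. -/
def IsRealRooted (p : ℝ[X]) : Prop :=
  p = 0 ∨ ∀ z : ℂ, aeval z p = 0 → z.im = 0

open ComplexConjugate

/-! ### Signed permutations as words. -/

namespace SignedPerm

variable {d : ℕ}

/-! When `σ_1 > 0` there is no descent at 0, so `des` may be replaced by `innerDes`, whose
generating functions satisfy one recursion for all first letters of either sign. Deleting the first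
letter `j` and standardising gives (`innerGen_succ`) `G_{d+1,j} = z ∑_{k<p} G_{d,k} + ∑_{k≥p}
G_{d,k}`, with `p` nondecreasing in `j`; standardisation keeps the sign of the last entry.

Instead of interlacing of roots, fix `z` with `Im z > 0`. The values `G_{d,k}(z)`, as `k` grows,
turn counterclockwise inside a sector of angle `arg z`, and the recursion preserves this
(`SectorOrdered.eulerianTransform`). The sector is narrower than a half-plane, so cancellation is
impossible: a nonzero total at `d` makes each `G_{d+1,j}(z)` nonzero, hence also the total at `d +
1`. So there are no zeros in the upper half-plane, and conjugation excludes the lower one. -/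

lemma entry_eq (σ : SignedPerm d) {i : ℕ} (h₁ : 1 ≤ i) (h₂ : i ≤ d) :
    σ.entry i = (σ.1 ⟨(i : ℤ), by omega⟩ : ℤ) := by
  rw [entry, dif_pos ⟨h₁, h₂⟩]

lemma entry_mem (σ : SignedPerm d) {i : ℕ} (h₁ : 1 ≤ i) (h₂ : i ≤ d) :
    σ.entry i ≠ 0 ∧ -(d : ℤ) ≤ σ.entry i ∧ σ.entry i ≤ d := by
  rw [entry_eq σ h₁ h₂]
  exact (σ.1 _).2

lemma eq_of_natAbs_entry_eq (σ : SignedPerm d) {i k : ℕ} (hi₁ : 1 ≤ i) (hi₂ : i ≤ d)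
    (hk₁ : 1 ≤ k) (hk₂ : k ≤ d) (h : (σ.entry i).natAbs = (σ.entry k).natAbs) : i = k := by
  rw [entry_eq σ hi₁ hi₂, entry_eq σ hk₁ hk₂] at h
  rcases Int.natAbs_eq_natAbs_iff.1 h with h | h
  · have := congrArg Subtype.val (σ.1.injective (Subtype.ext h))
    simp only at this
    omega
  · have h' : σ.1 ⟨(i : ℤ), by omega⟩ = σ.1 (-⟨(k : ℤ), by omega⟩) := by
      rw [σ.2]
      exact Subtype.ext h
    have : (i : ℤ) = -(k : ℤ) := congrArg Subtype.val (σ.1.injective h')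
    omega

lemma ext_entry {σ τ : SignedPerm d}
    (h : ∀ i, 1 ≤ i → i ≤ d → σ.entry i = τ.entry i) : σ = τ := by
  have pos : ∀ x : SignedSet d, 0 < x.1 → σ.1 x = τ.1 x := by
    rintro ⟨x, hx⟩ hpos
    simp only at hpos
    lift x to ℕ using hpos.le
    have := h x (by omega) (by omega)
    rw [entry_eq σ (by omega) (by omega), entry_eq τ (by omega) (by omega)] at this
    exact Subtype.ext this
  refine Subtype.ext (Equiv.ext fun x => ?_)
  rcases lt_or_gt_of_ne x.2.1 with hx | hx
  · have h' := pos (-x) (by change 0 < -x.1; omega)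
    rw [σ.2, τ.2] at h'
    have h'' : -(σ.1 x).1 = -(τ.1 x).1 := congrArg Subtype.val h'
    exact Subtype.ext (by omega)
  · exact pos x hx

/-- Every word with distinct absolute values in `{1, …, d}` is the window of a signed
permutation. -/
lemma exists_entry_eq (w : ℕ → ℤ)
    (hw : ∀ i, 1 ≤ i → i ≤ d → w i ≠ 0 ∧ -(d : ℤ) ≤ w i ∧ w i ≤ d)
    (hinj : ∀ i k, 1 ≤ i → i ≤ d → 1 ≤ k → k ≤ d → (w i).natAbs = (w k).natAbs → i = k) :
    ∃ σ : SignedPerm d, ∀ i, 1 ≤ i → i ≤ d → σ.entry i = w i := by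
  let f : SignedSet d → SignedSet d := fun x =>
    ⟨if 0 < x.1 then w x.1.natAbs else -w x.1.natAbs, by
      have hx := x.2
      have := hw x.1.natAbs (by omega) (by omega)
      split_ifs <;> omega⟩
  have hf : Function.Injective f := by
    intro x y hxy
    have h : (if 0 < x.1 then w x.1.natAbs else -w x.1.natAbs) =
      if 0 < y.1 then w y.1.natAbs else -w y.1.natAbs := congrArg Subtype.val hxy
    have hx := x.2
    have hy := y.2
    have e : x.1.natAbs = y.1.natAbs :=
      hinj _ _ (by omega) (by omega) (by omega) (by omega) (by split_ifs at h <;> omega)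
    have h0 := hw x.1.natAbs (by omega) (by omega)
    rw [← e] at h
    apply Subtype.ext
    split_ifs at h <;> omega
  refine ⟨⟨Equiv.ofBijective f (Finite.injective_iff_bijective.1 hf), fun x => ?_⟩,
    fun i h₁ h₂ => ?_⟩
  · apply Subtype.ext
    change (if 0 < -x.1 then w (-x.1).natAbs else -w (-x.1).natAbs) =
      -(if 0 < x.1 then w x.1.natAbs else -w x.1.natAbs)
    have hx := x.2
    rw [Int.natAbs_neg]
    split_ifs <;> omega
  · rw [entry_eq _ h₁ h₂]
    change (if 0 < (i : ℤ) then w (i : ℤ).natAbs else -w (i : ℤ).natAbs) = w i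
    rw [if_pos (by omega), Int.natAbs_natCast]

/-! ### Prepending and deleting the first letter. -/

/-- The odd order embedding of the nonzero integers that omits `±m`. -/
def shift (m : ℕ) (k : ℤ) : ℤ :=
  if k ≤ -(m : ℤ) then k - 1 else if (m : ℤ) ≤ k then k + 1 else k

lemma shift_lt_shift_iff (m : ℕ) (a b : ℤ) : shift m a < shift m b ↔ a < b := by
  unfold shift
  split_ifs <;> omega

lemma natAbs_shift_inj {m : ℕ} {a b : ℤ}
    (h : (shift m a).natAbs = (shift m b).natAbs) : a.natAbs = b.natAbs := by
  unfold shift at h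
  split_ifs at h <;> omega

lemma exists_shift_eq {m : ℕ} (hm : 1 ≤ m) {a : ℤ} (ha : a ≠ 0) (ham : a.natAbs ≠ m)
    (hmd : m ≤ d + 1) (had : a.natAbs ≤ d + 1) :
    ∃ k : ℤ, (k ≠ 0 ∧ -(d : ℤ) ≤ k ∧ k ≤ d) ∧ shift m k = a := by
  refine ⟨if a < -(m : ℤ) then a + 1 else if (m : ℤ) < a then a - 1 else a, ?_, ?_⟩
  · split_ifs <;> omega
  · unfold shift
    split_ifs <;> omega

/-- Prepending a first letter `j` to a signed permutation. -/
lemma exists_cons (j : ℤ) (hj₀ : j ≠ 0) (hj : j.natAbs ≤ d + 1) (σ : SignedPerm d) :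
    ∃ τ : SignedPerm (d + 1), τ.entry 1 = j ∧
      ∀ i, 1 ≤ i → i ≤ d → τ.entry (i + 1) = shift j.natAbs (σ.entry i) := by
  obtain ⟨τ, hτ⟩ := exists_entry_eq (d := d + 1)
    (fun i => if i = 1 then j else shift j.natAbs (σ.entry (i - 1))) (by
      intro i h₁ h₂
      split_ifs with h
      · omega
      · have := σ.entry_mem (i := i - 1) (by omega) (by omega)
        unfold shift
        split_ifs <;> omega) (by
      intro i k hi₁ hi₂ hk₁ hk₂ h
      split_ifs at h with h₁ h₂ h₂
      · omega
      · have := σ.entry_mem (i := k - 1) (by omega) (by omega)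
        unfold shift at h
        split_ifs at h <;> omega
      · have := σ.entry_mem (i := i - 1) (by omega) (by omega)
        unfold shift at h
        split_ifs at h <;> omega
      · have := σ.eq_of_natAbs_entry_eq (by omega) (by omega) (by omega) (by omega)
          (natAbs_shift_inj h)
        omega)
  refine ⟨τ, by simpa using hτ 1 le_rfl (by omega), fun i h₁ h₂ => ?_⟩
  rw [hτ (i + 1) (by omega) (by omega), if_neg (by omega), Nat.add_sub_cancel]

/-- Deleting the first letter of a signed permutation. -/
lemma exists_tail (τ : SignedPerm (d + 1)) :
    ∃ σ : SignedPerm d,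
      ∀ i, 1 ≤ i → i ≤ d → τ.entry (i + 1) = shift (τ.entry 1).natAbs (σ.entry i) := by
  have h1 := τ.entry_mem (i := 1) le_rfl (by omega)
  have H : ∀ i, 1 ≤ i → i ≤ d → ∃ k : ℤ, (k ≠ 0 ∧ -(d : ℤ) ≤ k ∧ k ≤ d) ∧
      shift (τ.entry 1).natAbs k = τ.entry (i + 1) := by
    intro i hi₁ hi₂
    have h := τ.entry_mem (i := i + 1) (by omega) (by omega)
    refine exists_shift_eq (by omega) h.1 (fun e => ?_) (by omega) (by omega)
    have := τ.eq_of_natAbs_entry_eq (by omega) (by omega) (by omega) (by omega) e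
    omega
  choose! w hw using H
  obtain ⟨σ, hσ⟩ := exists_entry_eq (d := d) w (fun i h₁ h₂ => (hw i h₁ h₂).1) (by
    intro i k hi₁ hi₂ hk₁ hk₂ h
    have e : (shift (τ.entry 1).natAbs (w i)).natAbs =
        (shift (τ.entry 1).natAbs (w k)).natAbs := by
      rcases Int.natAbs_eq_natAbs_iff.1 h with h | h
      · rw [h]
      · have := hw k hk₁ hk₂
        rw [h]
        unfold shift
        split_ifs <;> omega
    rw [(hw i hi₁ hi₂).2, (hw k hk₁ hk₂).2] at e
    have := τ.eq_of_natAbs_entry_eq (by omega) (by omega) (by omega) (by omega) e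
    omega)
  exact ⟨σ, fun i h₁ h₂ => by rw [hσ i h₁ h₂, (hw i h₁ h₂).2]⟩

/-- The number of descents of `σ` at the positions `1, …, d - 1`. -/
def innerDes (σ : SignedPerm d) : ℕ :=
  ((Finset.range (d - 1)).filter fun i => σ.entry (i + 1) > σ.entry (i + 2)).card

lemma entry_zero (σ : SignedPerm d) : σ.entry 0 = 0 := by
  rw [entry, dif_neg (by omega)]

lemma card_filter_range_succ (p : ℕ → Prop) [DecidablePred p] (n : ℕ) :
    ((Finset.range (n + 1)).filter p).card =
      ((Finset.range n).filter fun i => p (i + 1)).card + if p 0 then 1 else 0 := by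
  simp only [Finset.card_filter]
  exact Finset.sum_range_succ' _ n

lemma des_eq_innerDes (hd : 1 ≤ d) (σ : SignedPerm d) (h : 0 < σ.entry 1) :
    σ.des = σ.innerDes := by
  obtain ⟨n, rfl⟩ : ∃ n, d = n + 1 := ⟨d - 1, by omega⟩
  rw [des, descentSet, card_filter_range_succ, entry_zero, if_neg (by simpa using h.le)]
  rfl

lemma innerDes_of_cons (hd : 1 ≤ d) {m : ℕ} {σ : SignedPerm d} {τ : SignedPerm (d + 1)}
    (h : ∀ i, 1 ≤ i → i ≤ d → τ.entry (i + 1) = shift m (σ.entry i)) :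
    τ.innerDes = σ.innerDes + if τ.entry 1 > shift m (σ.entry 1) then 1 else 0 := by
  obtain ⟨n, rfl⟩ : ∃ n, d = n + 1 := ⟨d - 1, by omega⟩
  rw [innerDes, innerDes, Nat.add_sub_cancel, Nat.add_sub_cancel, card_filter_range_succ]
  congr 1
  · congr 1
    refine Finset.filter_congr fun i hi => ?_
    rw [Finset.mem_range] at hi
    rw [h (i + 1) (by omega) (by omega), h (i + 2) (by omega) (by omega)]
    exact shift_lt_shift_iff _ _ _
  · rw [h 1 le_rfl (by omega)]

/-- The signed permutations with first entry `j` and last entry satisfying `s`. -/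
def withEnds (s : ℤ → Prop) [DecidablePred s] (d : ℕ) (j : ℤ) : Finset (SignedPerm d) :=
  Finset.univ.filter fun σ => s (σ.entry d) ∧ σ.entry 1 = j

/-- The generating function of `innerDes` on `withEnds s d j`, evaluated at `z`. -/
noncomputable def innerGen (s : ℤ → Prop) [DecidablePred s] (z : ℂ) (d : ℕ) (j : ℤ) : ℂ :=
  ∑ σ ∈ withEnds s d j, z ^ σ.innerDes

/-! ### The recursion on the first letter. -/

section Recursion

variable (s : ℤ → Prop) [DecidablePred s] (z : ℂ)

lemma innerGen_eq_zero (hd : 1 ≤ d) {j : ℤ} (hj : ¬(j ≠ 0 ∧ j.natAbs ≤ d)) :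
    innerGen s z d j = 0 := by
  refine Finset.sum_eq_zero fun σ hσ => absurd ?_ hj
  have := (Finset.mem_filter.1 hσ).2.2
  have := σ.entry_mem le_rfl hd
  omega

/-- The number of letters below `j`, after standardisation, is governed by this threshold. -/
def threshold (j : ℤ) : ℤ := if 0 < j then j else j + 1

lemma threshold_mono : Monotone threshold := by
  intro a b h
  unfold threshold
  split_ifs <;> omega

lemma shift_lt_iff (j k : ℤ) :
    j > shift j.natAbs k ↔ k < threshold j := by
  unfold shift threshold
  split_ifs <;> omega

variable {s} in
lemma sum_innerGen_fiber (hd : 1 ≤ d) (w : ℤ → ℂ) :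
    ∑ k ∈ Finset.Icc (-(d : ℤ)) d, w k * innerGen s z d k =
      ∑ σ : SignedPerm d with s (σ.entry d), w (σ.entry 1) * z ^ σ.innerDes := by
  have hmaps : ∀ σ ∈ (Finset.univ.filter fun σ : SignedPerm d => s (σ.entry d)),
      σ.entry 1 ∈ Finset.Icc (-(d : ℤ)) d := fun σ _ =>
    Finset.mem_Icc.2 (σ.entry_mem le_rfl hd).2
  rw [← Finset.sum_fiberwise_of_maps_to hmaps]
  refine Finset.sum_congr rfl fun k _ => ?_
  rw [innerGen, withEnds, Finset.mul_sum, Finset.filter_filter]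
  refine Finset.sum_congr rfl fun σ hσ => ?_
  rw [(Finset.mem_filter.1 hσ).2.2]

variable {s} in
-- Prepending `j` is a bijection that creates one possible new descent, at position 1, decided by
-- comparing the old first letter with `threshold j`. The index `k = 0` contributes nothing.
lemma innerGen_succ (hs : ∀ m k, k ≠ 0 → (s (shift m k) ↔ s k)) (hd : 1 ≤ d) {j : ℤ}
    (hj₀ : j ≠ 0) (hj : j.natAbs ≤ d + 1) :
    innerGen s z (d + 1) j = ∑ k ∈ Finset.Icc (-(d : ℤ)) d,
      (if k < threshold j then z else 1) * innerGen s z d k := by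
  rw [sum_innerGen_fiber z hd (fun k => if k < threshold j then z else 1), innerGen]
  choose τ hτ₁ hτ using exists_cons (d := d) j hj₀ hj
  symm
  refine Finset.sum_bij (fun σ _ => τ σ) ?_ ?_ ?_ ?_
  · intro σ hσ
    refine Finset.mem_filter.2 ⟨Finset.mem_univ _, ?_, hτ₁ σ⟩
    rw [hτ σ d hd le_rfl, hs _ _ (σ.entry_mem hd le_rfl).1]
    exact (Finset.mem_filter.1 hσ).2
  · intro σ _ σ' _ h
    refine ext_entry fun i h₁ h₂ => ?_
    have h' : shift j.natAbs (σ.entry i) = shift j.natAbs (σ'.entry i) := by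
      rw [← hτ σ i h₁ h₂, ← hτ σ' i h₁ h₂, h]
    have a := shift_lt_shift_iff j.natAbs (σ.entry i) (σ'.entry i)
    have b := shift_lt_shift_iff j.natAbs (σ'.entry i) (σ.entry i)
    omega
  · intro ρ hρ
    obtain ⟨hρs, hρ₁⟩ := (Finset.mem_filter.1 hρ).2
    obtain ⟨σ, hσ⟩ := exists_tail ρ
    rw [hρ₁] at hσ
    refine ⟨σ, Finset.mem_filter.2 ⟨Finset.mem_univ _, ?_⟩, ext_entry fun i h₁ h₂ => ?_⟩
    · rwa [hσ d hd le_rfl, hs _ _ (σ.entry_mem hd le_rfl).1] at hρs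
    · rcases Nat.lt_or_ge 1 i with hi | hi
      · obtain ⟨i, rfl⟩ : ∃ n, i = n + 1 := ⟨i - 1, by omega⟩
        rw [hσ i (by omega) (by omega), hτ σ i (by omega) (by omega)]
      · obtain rfl : i = 1 := by omega
        rw [hτ₁, hρ₁]
  · intro σ _
    rw [innerDes_of_cons hd (hτ σ), hτ₁, pow_add, mul_comm]
    congr 1
    have := shift_lt_iff j (σ.entry 1)
    by_cases h : σ.entry 1 < threshold j
    · rw [if_pos h, if_pos (this.2 h), pow_one]
    · rw [if_neg h, if_neg (mt this.1 h), pow_zero]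

end Recursion

end SignedPerm

/-! ### Sector-ordered sequences of complex numbers. -/

/-- The values at `z` of an interlacing sequence: their arguments increase within a sector of
angle `arg z`. -/
def SectorOrdered (z : ℂ) (c : ℤ → ℂ) : Prop :=
  ∀ ⦃i k : ℤ⦄, i ≤ k → 0 ≤ (c k * conj (c i)).im ∧ 0 ≤ (z * c i * conj (c k)).im

lemma sum_mul_conj_sum_im_nonneg {ι κ : Type*} (S : Finset ι) (T : Finset κ) (f : ι → ℂ)
    (g : κ → ℂ) (h : ∀ i ∈ S, ∀ k ∈ T, 0 ≤ (f i * conj (g k)).im) :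
    0 ≤ ((∑ i ∈ S, f i) * conj (∑ k ∈ T, g k)).im := by
  rw [map_sum, Finset.sum_mul_sum, Complex.im_sum]
  refine Finset.sum_nonneg fun i hi => ?_
  rw [Complex.im_sum]
  exact Finset.sum_nonneg fun k hk => h i hi k hk

/-- The linear transformation `c ↦ z ∑_{k < p} c k + ∑_{k ≥ p} c k`. -/
noncomputable def eulerianTransform (z : ℂ) (S : Finset ℤ) (c : ℤ → ℂ) (p : ℤ) : ℂ :=
  ∑ k ∈ S, (if k < p then z else 1) * c k

lemma eulerianTransform_eq (z : ℂ) (S : Finset ℤ) (c : ℤ → ℂ) (p : ℤ) :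
    eulerianTransform z S c p =
      z * ∑ k ∈ S with k < p, c k + ∑ k ∈ S with ¬k < p, c k := by
  rw [eulerianTransform, ← Finset.sum_filter_add_sum_filter_not S (fun k => k < p),
    Finset.mul_sum]
  congr 1 <;> refine Finset.sum_congr rfl fun k hk => ?_
  · rw [if_pos (Finset.mem_filter.1 hk).2]
  · rw [if_neg (Finset.mem_filter.1 hk).2, one_mul]

namespace SectorOrdered

variable {z : ℂ} {c : ℤ → ℂ}

lemma sum_sum (hc : SectorOrdered z c) {S T : Finset ℤ} (h : ∀ i ∈ S, ∀ k ∈ T, i ≤ k) :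
    0 ≤ ((∑ k ∈ T, c k) * conj (∑ i ∈ S, c i)).im ∧
      0 ≤ (z * (∑ i ∈ S, c i) * conj (∑ k ∈ T, c k)).im := by
  refine ⟨sum_mul_conj_sum_im_nonneg _ _ _ _ fun k hk i hi => (hc (h i hi k hk)).1, ?_⟩
  rw [Finset.mul_sum]
  exact sum_mul_conj_sum_im_nonneg _ _ _ _ fun i hi k hk => (hc (h i hi k hk)).2

lemma eulerianTransform (hz : 0 < z.im) (hc : SectorOrdered z c) (S : Finset ℤ) :
    SectorOrdered z (eulerianTransform z S c) := by
  intro p q hpq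
  set A := ∑ k ∈ S with k < p, c k with hA
  set M := ∑ k ∈ S with ¬k < p ∧ k < q, c k with hM
  set C := ∑ k ∈ S with ¬k < q, c k with hC
  have hp : _root_.eulerianTransform z S c p = z * A + (M + C) := by
    rw [eulerianTransform_eq, ← Finset.sum_filter_add_sum_filter_not
      (S.filter fun k => ¬k < p) (fun k => k < q), Finset.filter_filter, Finset.filter_filter]
    congr 3
    exact Finset.filter_congr fun k _ => by omega
  have hq : _root_.eulerianTransform z S c q = z * (A + M) + C := by
    rw [eulerianTransform_eq, ← Finset.sum_filter_add_sum_filter_not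
      (S.filter fun k => k < q) (fun k => k < p), Finset.filter_filter, Finset.filter_filter]
    congr 4 <;> exact Finset.filter_congr fun k _ => by omega
  obtain ⟨AM, MA⟩ : 0 ≤ (M * conj A).im ∧ 0 ≤ (z * A * conj M).im :=
    hc.sum_sum fun i hi k hk => by
      rw [Finset.mem_filter] at hi hk
      omega
  obtain ⟨AC, CA⟩ : 0 ≤ (C * conj A).im ∧ 0 ≤ (z * A * conj C).im :=
    hc.sum_sum fun i hi k hk => by
      rw [Finset.mem_filter] at hi hk
      omega
  obtain ⟨MC, CM⟩ : 0 ≤ (C * conj M).im ∧ 0 ≤ (z * M * conj C).im :=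
    hc.sum_sum fun i hi k hk => by
      rw [Finset.mem_filter] at hi hk
      omega
  have zz := Complex.normSq_nonneg z
  have MM := mul_nonneg hz.le (Complex.normSq_nonneg M)
  have DD := mul_nonneg hz.le (Complex.normSq_nonneg (z * A + C))
  have AM' := mul_nonneg zz AM
  have MA' := mul_nonneg zz MA
  have MC' := mul_nonneg zz MC
  -- With `D = z A + C` the two values are `D + M` and `D + z M`. In both products the squared
  -- moduli leave only `Im z` times `|M|²` or `|D|²`, and the cross terms are the nonnegative
  -- quantities above.
  rw [hp, hq]
  clear_value A M C
  simp only [Complex.normSq_apply, Complex.mul_im, Complex.mul_re, Complex.add_re, Complex.add_im,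
    Complex.conj_re, Complex.conj_im] at *
  constructor
  · linarith
  · linarith

/-- If the sum vanished, the later terms would add up to `-c a`, which lies outside the sector
starting at `c a`. -/
lemma sum_ne_zero (hz : 0 < z.im) (hc : SectorOrdered z c) {S : Finset ℤ} {a : ℤ} (ha : a ∈ S)
    (hmin : ∀ k ∈ S, a ≤ k) (h0 : c a ≠ 0) : ∑ k ∈ S, c k ≠ 0 := by
  intro h
  rw [← Finset.add_sum_erase S c ha] at h
  have h₁ := (hc.sum_sum (S := {a}) (T := S.erase a) fun i hi k hk => by
    rw [Finset.mem_singleton.1 hi]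
    exact hmin k (Finset.mem_of_mem_erase hk)).2
  rw [Finset.sum_singleton, eq_neg_of_add_eq_zero_right h] at h₁
  have h₂ := mul_pos hz (Complex.normSq_pos.2 h0)
  simp only [Complex.normSq_apply, Complex.mul_im, Complex.mul_re, Complex.neg_re, Complex.neg_im,
    Complex.conj_re, Complex.conj_im] at *
  linarith

/-- If the lower part `L` and the upper part `U` satisfy `U = -z L`, then `Im (U conj L) = -Im z
|L|²`, which forces `L = U = 0`. -/
lemma eulerianTransform_ne_zero (hz : 0 < z.im) (hc : SectorOrdered z c) {S : Finset ℤ}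
    (hS : ∑ k ∈ S, c k ≠ 0) (p : ℤ) : _root_.eulerianTransform z S c p ≠ 0 := by
  intro h
  rw [eulerianTransform_eq] at h
  have h₁ := (hc.sum_sum (S := S.filter fun k => k < p) (T := S.filter fun k => ¬k < p)
    fun i hi k hk => by
      rw [Finset.mem_filter] at hi hk
      omega).1
  rw [← Finset.sum_filter_add_sum_filter_not S (fun k => k < p)] at hS
  rw [eq_neg_of_add_eq_zero_right h] at h₁ hS
  refine hS ?_
  have h0 : ∑ k ∈ S with k < p, c k = 0 := by
    by_contra h0
    have h₂ := mul_pos hz (Complex.normSq_pos.2 h0)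
    simp only [Complex.normSq_apply, Complex.mul_im, Complex.mul_re, Complex.neg_re,
      Complex.neg_im, Complex.conj_re, Complex.conj_im] at *
    linarith
  rw [h0, mul_zero, neg_zero, add_zero]

end SectorOrdered

/-! ### Nonvanishing in the upper half-plane and real-rootedness. -/

namespace SignedPerm

variable {s : ℤ → Prop} [DecidablePred s] {z : ℂ}

lemma innerGen_succ_ne_zero (hs : ∀ m k, k ≠ 0 → (s (shift m k) ↔ s k)) (hz : 0 < z.im) {d : ℕ}
    (hd : 1 ≤ d) (hc : SectorOrdered z (innerGen s z d))
    (h0 : ∑ k ∈ Finset.Icc (-(d : ℤ)) d, innerGen s z d k ≠ 0) {j : ℤ}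
    (hj₀ : j ≠ 0) (hj : j.natAbs ≤ d + 1) : innerGen s z (d + 1) j ≠ 0 := by
  rw [innerGen_succ z hs hd hj₀ hj]
  exact hc.eulerianTransform_ne_zero hz h0 (threshold j)

lemma innerGen_one (z : ℂ) (j : ℤ) : innerGen s z 1 j = (withEnds s 1 j).card := by
  rw [innerGen, Finset.sum_congr rfl fun σ _ => (by rfl : z ^ innerDes σ = z ^ 0)]
  simp

lemma sectorOrdered_innerGen (hs : ∀ m k, k ≠ 0 → (s (shift m k) ↔ s k)) (hs₁ : s 1 ∨ s (-1))
    (hz : 0 < z.im) {d : ℕ} (hd : 1 ≤ d) :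
    SectorOrdered z (innerGen s z d) ∧
      ∑ k ∈ Finset.Icc (-(d : ℤ)) d, innerGen s z d k ≠ 0 := by
  induction d, hd using Nat.le_induction with
  | base =>
    constructor
    · intro i k _
      -- For `d = 1` all values are nonnegative reals, so both conditions are immediate.
      simp only [innerGen_one, Complex.conj_natCast, mul_assoc]
      rw [← Nat.cast_mul, ← Nat.cast_mul, Complex.natCast_im, Complex.mul_im, Complex.natCast_im,
        Complex.natCast_re, mul_zero, zero_add]
      exact ⟨le_rfl, by positivity⟩
    · obtain ⟨j, hj, hsj⟩ : ∃ j : ℤ, (j = 1 ∨ j = -1) ∧ s j := by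
        rcases hs₁ with h | h
        exacts [⟨1, .inl rfl, h⟩, ⟨-1, .inr rfl, h⟩]
      obtain ⟨σ, hσ⟩ := exists_entry_eq (d := 1) (fun _ => j)
        (fun i _ _ => by push_cast; omega) (fun i k _ _ _ _ _ => by omega)
      have hσj := hσ 1 le_rfl le_rfl
      have hmem : σ ∈ withEnds s 1 j :=
        Finset.mem_filter.2 ⟨Finset.mem_univ _, by rwa [hσj], hσj⟩
      simp only [innerGen_one]
      rw [← Nat.cast_sum, Nat.cast_ne_zero]
      intro h
      have := Finset.sum_eq_zero_iff.1 h j (Finset.mem_Icc.2 (by push_cast; omega))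
      exact absurd (Finset.card_eq_zero.1 this) (Finset.ne_empty_of_mem hmem)
  | succ d hd ih =>
    have hc : SectorOrdered z (innerGen s z (d + 1)) := by
      intro i k hik
      by_cases hi : i ≠ 0 ∧ i.natAbs ≤ d + 1
      · by_cases hk : k ≠ 0 ∧ k.natAbs ≤ d + 1
        · rw [innerGen_succ z hs hd hi.1 hi.2, innerGen_succ z hs hd hk.1 hk.2]
          exact ih.1.eulerianTransform hz _ (threshold_mono hik)
        -- Indices that are not letters carry the value 0, which satisfies both inequalities.
        · simp [innerGen_eq_zero s z (by omega : 1 ≤ d + 1) hk]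
      · simp [innerGen_eq_zero s z (by omega : 1 ≤ d + 1) hi]
    refine ⟨hc, hc.sum_ne_zero hz (a := -((d + 1 : ℕ) : ℤ)) (Finset.mem_Icc.2 (by omega))
      (fun k hk => (Finset.mem_Icc.1 hk).1) ?_⟩
    exact innerGen_succ_ne_zero hs hz hd ih.1 ih.2 (by omega) (by omega)

/-- The generating polynomials of `des` over signed permutations with given positive first entry
and last entry satisfying a standardisation-invariant condition are real-rooted. -/
theorem isRealRooted_sum_withEnds (hs : ∀ m k, k ≠ 0 → (s (shift m k) ↔ s k)) (hs₁ : s 1 ∨ s (-1)) {d : ℕ}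
    (hd : 1 ≤ d) {j : ℤ} (hj₁ : 1 ≤ j) (hj₂ : j ≤ d) :
    IsRealRooted (∑ σ ∈ withEnds s d j, X ^ σ.des) := by
  have hdes : (∑ σ ∈ withEnds s d j, X ^ σ.des : ℝ[X]) =
      ∑ σ ∈ withEnds s d j, X ^ σ.innerDes := by
    refine Finset.sum_congr rfl fun σ hσ => ?_
    rw [des_eq_innerDes hd]
    rw [(Finset.mem_filter.1 hσ).2.2]
    omega
  have heval : ∀ z : ℂ, aeval z (∑ σ ∈ withEnds s d j, X ^ σ.innerDes : ℝ[X]) =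
      innerGen s z d j := by
    intro z
    simp [innerGen]
  rw [hdes]
  -- Only for `d = 1` can the polynomial be zero; there it is a constant.
  rcases hd.eq_or_lt with rfl | hd₂
  · refine or_iff_not_imp_left.2 fun h z hz => ?_
    rw [heval, innerGen_one, Nat.cast_eq_zero, Finset.card_eq_zero] at hz
    rw [hz, Finset.sum_empty] at h
    exact absurd rfl h
  · have upper : ∀ z : ℂ, 0 < z.im → innerGen s z d j ≠ 0 := by
      intro z hz
      obtain ⟨n, rfl⟩ : ∃ n, d = n + 1 := ⟨d - 1, by omega⟩
      obtain ⟨hc, h0⟩ := sectorOrdered_innerGen hs hs₁ hz (by omega : 1 ≤ n)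
      exact innerGen_succ_ne_zero hs hz (by omega) hc h0 (by omega) (by omega)
    refine Or.inr fun z hz => ?_
    rw [heval] at hz
    rcases lt_trichotomy z.im 0 with h | h | h
    · refine absurd ?_ (upper (conj z) (by simpa using h))
      have : innerGen s (conj z) d j = conj (innerGen s z d j) := by simp [innerGen]
      rw [this, hz, map_zero]
    · exact h
    · exact absurd hz (upper z h)

end SignedPerm

theorem mainTheorem5 (d : ℕ) (hd : 1 ≤ d) (j : ℤ) (hj₁ : 1 ≤ j) (hj₂ : j ≤ (d : ℤ)) :
    IsRealRooted (eulerianBPlus d j) ∧ IsRealRooted (eulerianBMinus d j) := by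
  constructor
  · refine SignedPerm.isRealRooted_sum_withEnds (s := fun x => 0 < x) (fun m k _ => ?_)
      (by norm_num) hd hj₁ hj₂
    unfold SignedPerm.shift
    split_ifs <;> omega
  · refine SignedPerm.isRealRooted_sum_withEnds (s := fun x => x < 0) (fun m k _ => ?_)
      (by norm_num) hd hj₁ hj₂
    unfold SignedPerm.shift
    split_ifs <;> omega
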